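/- Let $\beta>1$ be a real number, let $m\ge 0$ be an integer, let $F=\{0,1,\dots,m\}$, and let $$\Lambda_F=\{P(\beta) : P\in F[X]\}$$ be the set of all finite sums $\sum_i \varepsilon_i\beta^i$ with $\varepsilon_i\in F$. A subset $\Lambda$ of a metric space $X$ is a Delone set of $X$ if there are $r,R>0$ such that each ball of radius $r$ in $X$ contains at most one point of $\Lambda$ and each ball of radius $R$ in $X$ contains at least one point of $\Lambda$. A Delone set $\Lambda$ of $\mathbb R$ is a Meyer set if $\Lambda-\Lambda\subset\Lambda+G$ for some finite set $G\subset\mathbb R$. A set $\Lambda\subset[0,\infty)$ is a Meyer set of the half-line if it is a Delone set of the metric space $[0,\infty)$ and $(\Lambda-\Lambda)\cap[0,\infty)\subset\Lambda+G$ for some finite set $G\subset\mathbb R$. A Pisot number is a real algebraic integer $\beta>1$ all of whose other algebraic conjugates $\lambda\in\mathbb C$ satisfy $|\lambda|<1$. Then: 1. $\Lambda_F$ is a Meyer set of the half-line $[0,\infty)$ if and only if $\beta\le m+1$ and $\beta$ is a Pisot number. 2. $\Lambda_F\cup(-\Lambda_F)$ is a Meyer set (of $\mathbb R$) if and only if $\beta\le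 m+1$ and $\beta$ is a Pisot number. -/

import Mathlib

open scoped NNReal Polynomial Pointwise

/-- A subset of a metric space is a Delone set if it is uniformly discrete and relatively dense:
it is the underlying set of one of Mathlib's `DeloneSet`s (which carry a choice of radii). -/
def IsDelone {X : Type*} [MetricSpace X] (Λ : Set X) : Prop :=
  ∃ D : Delone.DeloneSet X, (D : Set X) = Λ

/-- A Meyer set is a Delone set `Λ` such that `Λ - Λ ⊆ Λ + F` for some finite set `F`. -/
def IsMeyer {E : Type*} [NormedAddCommGroup E] (Λ : Set E) : Prop :=
  IsDelone Λ ∧ ∃ F : Set E, F.Finite ∧ Λ - Λ ⊆ Λ + F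

/-- A Meyer set of the half-line `[0, ∞)`: a set of non-negative reals that is a Delone set of the
metric space `[0, ∞)` and whose non-negative differences lie in `Λ + F` for some finite set `F`. -/
def IsHalfLineMeyer (Λ : Set ℝ) : Prop :=
  Λ ⊆ Set.Ici 0 ∧ IsDelone ((fun x : ℝ≥0 => (x : ℝ)) ⁻¹' Λ) ∧
    ∃ F : Set ℝ, F.Finite ∧ (Λ - Λ) ∩ Set.Ici 0 ⊆ Λ + F

/-- A Pisot number: a real algebraic integer `β > 1` all of whose other algebraic conjugates
(the complex roots of its minimal polynomial over `ℚ`) have modulus smaller than `1`. -/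
def IsPisot (β : ℝ) : Prop :=
  1 < β ∧ IsIntegral ℤ β ∧ ∀ z ∈ (minpoly ℚ β).rootSet ℂ, z ≠ (β : ℂ) → ‖z‖ < 1

/-- The set `{P(β) : P ∈ F[X]}`, where `F[X]` is the set of polynomials whose coefficients all
belong to the set `F ∋ 0` of natural numbers. -/
def polynomialValues (F : Set ℕ) (β : ℝ) : Set ℝ :=
  {x | ∃ P : ℕ[X], (∀ i, P.coeff i ∈ F) ∧ Polynomial.aeval β P = x}

/-! Write L for the set of values. If `β` is Pisot, integer polynomials with bounded coefficients
have values at every other conjugate bounded by a geometric series; those with bounded value at `β`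
thus give finitely many algebraic integers (`IsPisot.isLocallyFinite`). Applied to differences in L,
this gives separation and the finite set, while `β ≤ m + 1` gives covering by greedy expansions.

Conversely, the Meyer property makes L - L - L locally finite, and relative density bounds the gap
of L below `β ^ n`, so `β ≤ m + 1`. Chains of bounded steps in L show that `ℤ[β]` is finitely
generated, so `β` is integral. For a conjugate `z ≠ β`, let s be the map P(β) ↦ P(z) and φ(x) its
value at a point of L near x. Local finiteness makes φ additive up to bounded error, so φ(βx) is
close to both βφ(x) and zφ(x); hence φ is bounded (`bounded_of_approx_additive`), and so is s on L.
Finite sums of distinct powers of z are then bounded, which forces |z| < 1. -/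

theorem isDelone_iff {X : Type*} [MetricSpace X] {Λ : Set X} :
    IsDelone Λ ↔ (∃ r : ℝ, 0 < r ∧ ∀ x ∈ Λ, ∀ y ∈ Λ, x ≠ y → r < dist x y) ∧
      ∃ R : ℝ, 0 < R ∧ ∀ x, ∃ y ∈ Λ, dist x y ≤ R := by
  constructor
  · rintro ⟨D, rfl⟩
    exact ⟨⟨D.packingRadius, D.packingRadius_pos,
      fun x hx y hy hxy => D.packingRadius_lt_dist_of_mem_ne hx hy hxy⟩,
      D.coveringRadius, D.coveringRadius_pos, D.exists_dist_le_coveringRadius⟩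
  · rintro ⟨⟨r, hr, hsep⟩, R, hR, hcov⟩
    lift r to ℝ≥0 using hr.le
    lift R to ℝ≥0 using hR.le
    refine ⟨⟨Λ, r, mod_cast hr, ?_, R, mod_cast hR, ?_⟩, rfl⟩
    · intro x hx y hy hxy
      change _ < edist x y
      rw [edist_nndist, ENNReal.coe_lt_coe, ← NNReal.coe_lt_coe]
      exact hsep x hx y hy hxy
    · intro x _
      obtain ⟨y, hy, hxy⟩ := hcov x
      refine ⟨y, hy, ?_⟩
      change edist x y ≤ _
      rw [edist_nndist, ENNReal.coe_le_coe, ← NNReal.coe_le_coe]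
      exact hxy

/-! ### Locally finite subsets of the line -/

/-- A set of real numbers with finitely many points in each bounded interval. -/
def IsLocallyFinite (S : Set ℝ) : Prop := ∀ T : ℝ, (S ∩ Set.Icc (-T) T).Finite

namespace IsLocallyFinite

variable {S S' G : Set ℝ}

theorem mono (h : IsLocallyFinite S) (hS : S' ⊆ S) : IsLocallyFinite S' := fun T =>
  (h T).subset (Set.inter_subset_inter_left _ hS)

theorem union (h : IsLocallyFinite S) (h' : IsLocallyFinite S') : IsLocallyFinite (S ∪ S') :=
  fun T => by
    rw [Set.union_inter_distrib_right]
    exact (h T).union (h' T)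

theorem neg (h : IsLocallyFinite S) : IsLocallyFinite (-S) := fun T => by
  refine ((h T).image (fun x => -x)).subset ?_
  rintro x ⟨hx, h1, h2⟩
  exact ⟨-x, ⟨hx, by linarith, by linarith⟩, neg_neg x⟩

theorem add_finite (h : IsLocallyFinite S) (hG : G.Finite) : IsLocallyFinite (S + G) := fun T => by
  refine (hG.biUnion fun g _ => (h (T + |g|)).image (fun x => x + g)).subset ?_
  rintro _ ⟨⟨x, hx, g, hg, rfl⟩, h1, h2⟩
  refine Set.mem_biUnion hg ⟨x, ⟨hx, ?_, ?_⟩, rfl⟩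
  · have := le_abs_self g
    simp only at h1 h2
    linarith
  · have := neg_abs_le g
    simp only at h1 h2
    linarith

theorem add_of_nonneg (h : IsLocallyFinite S) (hS : S ⊆ Set.Ici 0) : IsLocallyFinite (S + S) :=
  fun T => by
    refine ((h T).add (h T)).subset ?_
    rintro _ ⟨⟨x, hx, y, hy, rfl⟩, h1, h2⟩
    have hx0 : 0 ≤ x := hS hx
    have hy0 : 0 ≤ y := hS hy
    simp only at h1 h2
    exact ⟨x, ⟨hx, by linarith, by linarith⟩, y, ⟨hy, by linarith, by linarith⟩, rfl⟩

theorem of_separated {r : ℝ} (hr : 0 < r) (h : ∀ x ∈ S, ∀ y ∈ S, x ≠ y → r < |x - y|) :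
    IsLocallyFinite S := fun T => by
  refine Set.Finite.of_finite_image (f := fun x => ⌊x / r⌋)
    ((Set.finite_Icc ⌊-T / r⌋ ⌊T / r⌋).subset ?_) ?_
  · rintro _ ⟨x, ⟨_, h1, h2⟩, rfl⟩
    exact ⟨Int.floor_le_floor (by gcongr), Int.floor_le_floor (by gcongr)⟩
  · intro x hx y hy hxy
    by_contra hne
    have h1 := h x hx.1 y hy.1 hne
    have h2 := Int.abs_sub_lt_one_of_floor_eq_floor hxy
    rw [← sub_div, abs_div, abs_of_pos hr, div_lt_one hr] at h2
    linarith

/-- Nonzero elements of a locally finite set stay away from zero. -/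
theorem exists_lt_abs (h : IsLocallyFinite S) : ∃ r : ℝ, 0 < r ∧ ∀ x ∈ S, x ≠ 0 → r < |x| := by
  have hf : ((fun x : ℝ => |x|) '' ((S ∩ Set.Icc (-1) 1) \ {0})).Finite :=
    ((h 1).subset Set.sdiff_subset).image _
  have h0 : (0 : ℝ) ∉ (fun x : ℝ => |x|) '' ((S ∩ Set.Icc (-1) 1) \ {0}) := by
    rintro ⟨x, hx, hx0⟩
    exact hx.2 (abs_eq_zero.mp hx0)
  obtain ⟨ε, hε, hball⟩ := Metric.isOpen_iff.mp hf.isClosed.isOpen_compl 0 h0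
  refine ⟨min (ε / 2) (1 / 2), by positivity, fun x hx hx0 => ?_⟩
  by_contra! hle
  have hle1 : |x| ≤ 1 := by linarith [min_le_right (ε / 2) (1 / 2)]
  have hmem : |x| ∈ Metric.ball (0 : ℝ) ε := by
    rw [mem_ball_zero_iff, Real.norm_eq_abs, abs_abs]
    linarith [min_le_left (ε / 2) (1 / 2)]
  exact hball hmem ⟨x, ⟨⟨hx, abs_le.mp hle1⟩, hx0⟩, rfl⟩

end IsLocallyFinite

/-! ### Values of polynomials with digits at most `m` -/

section polynomialValues

variable {β : ℝ} {m : ℕ}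

theorem zero_mem_polynomialValues : (0 : ℝ) ∈ polynomialValues (Set.Icc 0 m) β :=
  ⟨0, fun i => by simp, by simp⟩

theorem nonneg_of_mem_polynomialValues {F : Set ℕ} (hβ : 0 ≤ β) {x : ℝ}
    (hx : x ∈ polynomialValues F β) : 0 ≤ x := by
  obtain ⟨P, _, rfl⟩ := hx
  rw [Polynomial.aeval_eq_sum_range]
  exact Finset.sum_nonneg fun i _ => by
    rw [nsmul_eq_mul]
    positivity

theorem mul_mem_polynomialValues {x : ℝ} (hx : x ∈ polynomialValues (Set.Icc 0 m) β) :
    β * x ∈ polynomialValues (Set.Icc 0 m) β := by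
  obtain ⟨P, hP, rfl⟩ := hx
  refine ⟨Polynomial.X * P, fun i => ?_, by simp⟩
  cases i with
  | zero => simp
  | succ i => simpa using hP i

theorem sum_pow_mem_polynomialValues (hm : 1 ≤ m) (S : Finset ℕ) :
    ∑ i ∈ S, β ^ i ∈ polynomialValues (Set.Icc 0 m) β := by
  refine ⟨∑ i ∈ S, Polynomial.X ^ i, fun i => ?_, by simp⟩
  simp only [Polynomial.finsetSum_coeff, Polynomial.coeff_X_pow, Finset.sum_ite_eq]
  split_ifs <;> simp [hm]

theorem exists_int_of_mem_polynomialValues {x : ℝ}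
    (hx : x ∈ polynomialValues (Set.Icc 0 m) β) :
    ∃ P : ℤ[X], (∀ i, |P.coeff i| ≤ m) ∧ Polynomial.aeval β P = x := by
  obtain ⟨P, hP, rfl⟩ := hx
  refine ⟨P.map (Nat.castRingHom ℤ), fun i => ?_, ?_⟩
  · have := (hP i).2
    simpa using this
  · exact Polynomial.aeval_map_algebraMap ℤ β P

/-- A nonzero leading coefficient is at least 1, so a value below `β ^ n` only uses powers below n.
This is what produces gaps when `β > m + 1`. -/
theorem le_of_mem_polynomialValues_of_lt (hβ : 1 < β) {x : ℝ} {n : ℕ}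
    (hx : x ∈ polynomialValues (Set.Icc 0 m) β) (hxn : x < β ^ n) :
    x * (β - 1) ≤ m * β ^ n := by
  obtain ⟨P, hP, rfl⟩ := hx
  have hβ0 : 0 < β := by linarith
  rcases eq_or_ne P 0 with rfl | hP0
  · rw [map_zero, zero_mul]
    positivity
  have hdeg : P.natDegree < n := by
    by_contra! hn
    have h1 : 1 ≤ P.coeff P.natDegree :=
      Nat.one_le_iff_ne_zero.mpr (Polynomial.leadingCoeff_ne_zero.mpr hP0)
    have h2 : P.coeff P.natDegree • β ^ P.natDegree ≤ Polynomial.aeval β P := by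
      rw [Polynomial.aeval_eq_sum_range]
      refine Finset.single_le_sum (f := fun i => P.coeff i • β ^ i) (fun i _ => ?_)
        (Finset.self_mem_range_succ _)
      rw [nsmul_eq_mul]
      positivity
    rw [nsmul_eq_mul] at h2
    have h3 : β ^ n ≤ β ^ P.natDegree := pow_le_pow_right₀ hβ.le hn
    have h4 : (1 : ℝ) ≤ P.coeff P.natDegree := by exact_mod_cast h1
    nlinarith [pow_pos hβ0 P.natDegree]
  rw [Polynomial.aeval_eq_sum_range' hdeg]
  have : ∑ i ∈ Finset.range n, P.coeff i • β ^ i ≤ ∑ i ∈ Finset.range n, m * β ^ i := by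
    refine Finset.sum_le_sum fun i _ => ?_
    rw [nsmul_eq_mul]
    have : (P.coeff i : ℝ) ≤ m := by exact_mod_cast (hP i).2
    gcongr
  rw [← Finset.mul_sum] at this
  calc _ ≤ (m * ∑ i ∈ Finset.range n, β ^ i) * (β - 1) := by
        gcongr
    _ = m * (β ^ n - 1) := by rw [mul_assoc, geom_sum_mul]
    _ ≤ m * β ^ n := by gcongr; linarith

end polynomialValues

/-! ### Finiteness at Pisot numbers -/

section Pisot

open IntermediateField

/-- The values at a Pisot number of the integer polynomials with bounded coefficients form a
locally finite set. -/
theorem IsPisot.isLocallyFinite {β : ℝ} (hβ : IsPisot β) (N : ℕ) :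
    IsLocallyFinite {x | ∃ P : ℤ[X], (∀ i, |P.coeff i| ≤ N) ∧ Polynomial.aeval β P = x} := by
  intro T
  obtain ⟨-, hint, hconj⟩ := hβ
  have hintQ : IsIntegral ℚ β := hint.tower_top
  have : FiniteDimensional ℚ ℚ⟮β⟯ := adjoin.finiteDimensional hintQ
  have : NumberField ℚ⟮β⟯ := { to_charZero := inferInstance, to_finiteDimensional := inferInstance }
  set g : ℚ⟮β⟯ := AdjoinSimple.gen ℚ β with hg
  have hgβ : (g : ℝ) = β := AdjoinSimple.coe_gen ℚ β
  have hgint : IsIntegral ℤ g := by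
    rw [← isIntegral_algebraMap_iff (algebraMap ℚ⟮β⟯ ℝ).injective]
    rwa [show algebraMap ℚ⟮β⟯ ℝ g = β from hgβ]
  set A : Set ℤ[X] := {P | (∀ i, |P.coeff i| ≤ N) ∧ |Polynomial.aeval β P| ≤ T} with hA
  have hmap : ∀ (φ : ℚ⟮β⟯ →+* ℂ) (P : ℤ[X]),
      φ (Polynomial.aeval g P) = Polynomial.aeval (φ g) P := fun φ P =>
    (Polynomial.aeval_algHom_apply φ.toIntAlgHom g P).symm
  have hbound : ∀ φ : ℚ⟮β⟯ →+* ℂ, ∃ B : ℝ, ∀ P ∈ A, ‖φ (Polynomial.aeval g P)‖ ≤ B := by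
    intro φ
    by_cases hφ : φ g = (β : ℂ)
    · refine ⟨T, fun P hP => ?_⟩
      have : Polynomial.aeval (β : ℂ) P = ((Polynomial.aeval β P : ℝ) : ℂ) :=
        Polynomial.aeval_algebraMap_apply ℂ β P
      rw [hmap, hφ, this, Complex.norm_real]
      exact hP.2
    · have hroot : φ g ∈ (minpoly ℚ β).rootSet ℂ := by
        rw [Polynomial.mem_rootSet]
        refine ⟨minpoly.ne_zero hintQ, ?_⟩
        have h1 : Polynomial.aeval g (minpoly ℚ β) = 0 := by
          rw [← minpoly_gen ℚ β]
          exact minpoly.aeval ℚ g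
        have h2 := Polynomial.aeval_algHom_apply φ.toRatAlgHom g (minpoly ℚ β)
        rw [h1, map_zero] at h2
        exact h2
      have hlt := hconj _ hroot hφ
      refine ⟨N * (1 - ‖φ g‖)⁻¹, fun P hP => ?_⟩
      rw [hmap, Polynomial.aeval_eq_sum_range]
      have hs := summable_geometric_of_lt_one (norm_nonneg (φ g)) hlt
      calc _ ≤ ∑ i ∈ Finset.range (P.natDegree + 1), (N : ℝ) * ‖φ g‖ ^ i := by
            refine norm_sum_le_of_le _ fun i _ => ?_
            rw [zsmul_eq_mul, norm_mul, norm_pow, Complex.norm_intCast]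
            have : (|P.coeff i| : ℝ) ≤ N := by exact_mod_cast hP.1 i
            gcongr
        _ = N * ∑ i ∈ Finset.range (P.natDegree + 1), ‖φ g‖ ^ i := by rw [Finset.mul_sum]
        _ ≤ N * (1 - ‖φ g‖)⁻¹ := by
            rw [← tsum_geometric_of_lt_one (norm_nonneg (φ g)) hlt]
            gcongr
            exact hs.sum_le_tsum _ fun i _ => by positivity
  choose B hB using hbound
  obtain ⟨C, hC⟩ := (Set.finite_range B).bddAbove
  refine ((NumberField.Embeddings.finite_of_norm_le ℚ⟮β⟯ ℂ C).image
    (fun x : ℚ⟮β⟯ => (x : ℝ))).subset ?_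
  rintro _ ⟨⟨P, hP, rfl⟩, hT⟩
  refine ⟨Polynomial.aeval g P, ⟨?_, fun φ => ?_⟩, ?_⟩
  · exact IsIntegral.of_mem_of_fg (Algebra.adjoin ℤ {g}) hgint.fg_adjoin_singleton _
      (Polynomial.aeval_mem_adjoin_singleton ℤ g)
  · exact (hB φ P ⟨hP, abs_le.mpr hT⟩).trans (hC ⟨φ, rfl⟩)
  · have := Polynomial.aeval_algebraMap_apply ℝ g P
    change Polynomial.aeval (g : ℝ) P = _ at this
    rw [hgβ] at this
    exact this.symm

end Pisot

/-! ### Greedy expansions -/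

theorem exists_mem_polynomialValues_of_lt_pow {β : ℝ} (hβ : 1 < β) {m : ℕ} (hm : β ≤ m + 1)
    (n : ℕ) : ∀ x : ℝ, 0 ≤ x → x < β ^ n → ∃ P : ℕ[X], (∀ i, P.coeff i ≤ m) ∧ (∀ i, n ≤ i → P.coeff i = 0) ∧
      0 ≤ x - Polynomial.aeval β P ∧ x - Polynomial.aeval β P < 1 := by
  induction n with
  | zero =>
    intro x hx hx1
    exact ⟨0, by simp, by simp, by simpa using hx, by simpa using hx1⟩
  | succ n ih =>
    intro x hx hx1
    have hpow : 0 < β ^ n := pow_pos (by linarith) n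
    have hq : 0 ≤ x / β ^ n := by positivity
    set d := ⌊x / β ^ n⌋₊ with hd
    have h1 : (d : ℝ) ≤ x / β ^ n := Nat.floor_le hq
    have h2 : x / β ^ n < d + 1 := Nat.lt_floor_add_one _
    rw [le_div_iff₀ hpow] at h1
    rw [div_lt_iff₀ hpow] at h2
    -- The greedy digit is admissible because `x / β ^ n < β ≤ m + 1`.
    have hdm : d ≤ m := by
      rw [hd, ← Nat.lt_succ_iff, Nat.floor_lt hq, div_lt_iff₀ hpow]
      rw [pow_succ] at hx1
      push_cast
      nlinarith
    obtain ⟨P, hP, hP0, hx0, hx1⟩ := ih (x - d * β ^ n) (by linarith) (by linarith)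
    refine ⟨P + Polynomial.monomial n d, fun i => ?_, fun i hi => ?_, ?_, ?_⟩
    · rw [Polynomial.coeff_add, Polynomial.coeff_monomial]
      split_ifs with h
      · rw [hP0 i h.le, zero_add]
        exact hdm
      · exact hP i
    · rw [Polynomial.coeff_add, Polynomial.coeff_monomial, if_neg (by omega), hP0 i (by omega), add_zero]
    all_goals
      rw [map_add, Polynomial.aeval_monomial, eq_natCast]
      linarith

theorem exists_mem_polynomialValues_near {β : ℝ} (hβ : 1 < β) {m : ℕ} (hm : β ≤ m + 1)
    {x : ℝ} (hx : 0 ≤ x) :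
    ∃ y ∈ polynomialValues (Set.Icc 0 m) β, |x - y| ≤ 1 := by
  obtain ⟨n, hn⟩ := pow_unbounded_of_one_lt x hβ
  obtain ⟨P, hP, -, h0, h1⟩ := exists_mem_polynomialValues_of_lt_pow hβ hm n x hx hn
  exact ⟨_, ⟨P, fun i => ⟨Nat.zero_le _, hP i⟩, rfl⟩, abs_le.mpr ⟨by linarith, h1.le⟩⟩

/-! ### Approximately additive functions and conjugates -/

/-- An approximately additive function on the half-line which is bounded on bounded sets
approximately commutes with the multiplication by `β`, so it is bounded if multiplying its
argument by `β` multiplies it by some other factor, up to a bounded error. -/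
theorem bounded_of_approx_additive {φ : ℝ → ℂ} {C β : ℝ} {z : ℂ} (hβ : 0 ≤ β) (hz : z ≠ β)
    (hadd : ∀ x y, 0 ≤ x → 0 ≤ y → ‖φ (x + y) - φ x - φ y‖ ≤ C)
    (hmul : ∀ x, 0 ≤ x → ‖φ (β * x) - z * φ x‖ ≤ C)
    (hloc : ∀ T, ∃ K, ∀ x, 0 ≤ x → x ≤ T → ‖φ x‖ ≤ K) :
    ∃ B, ∀ x, 0 ≤ x → ‖φ x‖ ≤ B := by
  have hC : 0 ≤ C := (norm_nonneg _).trans (hadd 0 0 le_rfl le_rfl)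
  have hnat : ∀ x, 0 ≤ x → ∀ n : ℕ, ‖φ (n * x) - n * φ x‖ ≤ (n + 1) * C := by
    intro x hx n
    induction n with
    | zero =>
      have := hadd 0 0 le_rfl le_rfl
      simpa using this
    | succ n ih =>
      have h1 := hadd (n * x) x (by positivity) hx
      have h2 := norm_add_le (φ (n * x + x) - φ (n * x) - φ x) (φ (n * x) - n * φ x)
      push_cast
      rw [show ((n : ℝ) + 1) * x = n * x + x by ring,
        show φ (n * x + x) - (n + 1) * φ x =
          (φ (n * x + x) - φ (n * x) - φ x) + (φ (n * x) - n * φ x) by ring]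
      linarith
  have hhom : ∀ x, 0 ≤ x → ‖φ (β * x) - β * φ x‖ ≤ C + β * C := by
    intro x hx
    obtain ⟨K, hK⟩ := hloc x
    -- Compare φ(nβx) with nφ(βx) and, via the integer part p of nβ, with pφ(x). The terms not
    -- proportional to n disappear on dividing by n.
    have key : ∀ n : ℕ, n * ‖φ (β * x) - β * φ x‖ ≤
        n * (C + β * C) + (3 * C + K + ‖φ x‖) := by
      intro n
      have hnβ : 0 ≤ n * β := by positivity
      set p := ⌊n * β⌋₊ with hp
      have h1 : (p : ℝ) ≤ n * β := Nat.floor_le hnβ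
      have h2 : n * β < p + 1 := Nat.lt_floor_add_one _
      set r := n * β - p with hr
      have hr0 : 0 ≤ r := by linarith
      have hr1 : r ≤ 1 := by linarith
      have e1 := hnat (β * x) (by positivity) n
      have e2 := hadd (p * x) (r * x) (by positivity) (by positivity)
      have e3 := hnat x hx p
      have e4 := hK (r * x) (by positivity) (by nlinarith)
      rw [show p * x + r * x = n * (β * x) by rw [hr]; ring] at e2
      have e5 : ‖(r : ℂ) * φ x‖ ≤ ‖φ x‖ := by
        rw [norm_mul, Complex.norm_real, Real.norm_of_nonneg hr0]
        nlinarith [norm_nonneg (φ x)]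
      have hrC : (r : ℂ) = n * β - p := by rw [hr]; push_cast; ring
      have e6 : (n : ℂ) * (φ (β * x) - β * φ x) =
          -(φ (n * (β * x)) - n * φ (β * x)) + (φ (n * (β * x)) - φ (p * x) - φ (r * x))
            + (φ (p * x) - p * φ x) + φ (r * x) - r * φ x := by
        rw [hrC]; ring
      have e7 : n * ‖φ (β * x) - β * φ x‖ = ‖(n : ℂ) * (φ (β * x) - β * φ x)‖ := by
        rw [norm_mul, Complex.norm_natCast]
      rw [e7, e6]
      have n1 := norm_sub_le (-(φ (n * (β * x)) - n * φ (β * x)) +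
        (φ (n * (β * x)) - φ (p * x) - φ (r * x)) + (φ (p * x) - p * φ x) + φ (r * x)) (r * φ x)
      have n2 := norm_add₄_le (a := -(φ (n * (β * x)) - n * φ (β * x)))
        (b := φ (n * (β * x)) - φ (p * x) - φ (r * x)) (c := φ (p * x) - p * φ x) (d := φ (r * x))
      rw [norm_neg] at n2
      have : p * C ≤ n * β * C := by gcongr
      nlinarith
    by_contra! hlt
    obtain ⟨n, hn⟩ := exists_nat_gt
      ((3 * C + K + ‖φ x‖) / (‖φ (β * x) - β * φ x‖ - (C + β * C)))
    rw [div_lt_iff₀ (by linarith)] at hn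
    have := key n
    linarith
  have hpos : 0 < ‖z - β‖ := norm_pos_iff.mpr (sub_ne_zero.mpr hz)
  refine ⟨(C + (C + β * C)) / ‖z - β‖, fun x hx => ?_⟩
  rw [le_div_iff₀ hpos, ← norm_mul]
  have h := norm_sub_le (φ (β * x) - β * φ x) (φ (β * x) - z * φ x)
  rw [show φ (β * x) - β * φ x - (φ (β * x) - z * φ x) = φ x * (z - β) by ring] at h
  linarith [hmul x hx, hhom x hx]

theorem summable_of_abs_sum_le {f : ℕ → ℝ} {B : ℝ} (h : ∀ S : Finset ℕ, |∑ i ∈ S, f i| ≤ B) :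
    Summable f := by
  refine Summable.of_abs (summable_of_sum_le (c := B + B) (fun i => abs_nonneg (f i)) fun S => ?_)
  rw [← Finset.sum_filter_add_sum_filter_not S (fun i => 0 ≤ f i)]
  refine add_le_add ?_ ?_
  · rw [Finset.sum_congr rfl fun i hi => abs_of_nonneg (Finset.mem_filter.mp hi).2]
    exact (le_abs_self _).trans (h _)
  · rw [Finset.sum_congr rfl fun i hi => abs_of_neg (not_le.mp (Finset.mem_filter.mp hi).2),
      Finset.sum_neg_distrib]
    exact (neg_le_abs _).trans (h _)

/-- Bounded finite subsums make the real and imaginary parts summable, so `z ^ i` tends to 0. -/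
theorem norm_lt_one_of_norm_sum_pow_le {z : ℂ} {B : ℝ}
    (h : ∀ S : Finset ℕ, ‖∑ i ∈ S, z ^ i‖ ≤ B) : ‖z‖ < 1 := by
  have hre : Summable fun i => (z ^ i).re := summable_of_abs_sum_le (B := B) fun S => by
    rw [← Complex.re_sum]
    exact (Complex.abs_re_le_norm _).trans (h S)
  have him : Summable fun i => (z ^ i).im := summable_of_abs_sum_le (B := B) fun S => by
    rw [← Complex.im_sum]
    exact (Complex.abs_im_le_norm _).trans (h S)
  rw [← tendsto_pow_atTop_nhds_zero_iff_norm_lt_one, tendsto_zero_iff_norm_tendsto_zero]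
  refine squeeze_zero (fun _ => norm_nonneg _) (fun i => Complex.norm_le_abs_re_add_abs_im (z ^ i)) ?_
  simpa using hre.tendsto_atTop_zero.abs.add him.tendsto_atTop_zero.abs

/-- Evaluation of integer polynomials at `β` determines their evaluation at a conjugate. -/
theorem exists_conjugation {β : ℝ} {z : ℂ}
    (hz : z ∈ (minpoly ℚ β).rootSet ℂ) :
    ∃ s : ℝ → ℂ, ∀ P : ℤ[X], s (Polynomial.aeval β P) = Polynomial.aeval z P := by
  -- Well defined because `minpoly ℚ β` divides P - Q whenever P and Q agree at `β`; the value 0 off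
  -- `ℤ[β]` is arbitrary.
  refine ⟨Function.extend (fun P : ℤ[X] => Polynomial.aeval β P)
    (fun P => Polynomial.aeval z P) 0, fun P => ?_⟩
  refine Function.FactorsThrough.extend_apply (f := fun P : ℤ[X] => Polynomial.aeval β P)
    (g := fun P => Polynomial.aeval z P) ?_ 0 P
  intro P Q hPQ
  simp only at hPQ ⊢
  rw [← sub_eq_zero, ← map_sub, ← Polynomial.aeval_map_algebraMap ℚ] at hPQ ⊢
  obtain ⟨D, hD⟩ := minpoly.dvd ℚ β hPQ
  rw [hD, map_mul, (Polynomial.mem_rootSet.mp hz).2, zero_mul]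

/-! ### Necessity -/

section Necessity

variable {β : ℝ} {m : ℕ}

theorem le_add_one_of_cover (hβ : 1 < β) {R : ℝ}
    (hcov : ∀ x, 0 ≤ x → ∃ y ∈ polynomialValues (Set.Icc 0 m) β, |x - y| ≤ R) :
    β ≤ m + 1 := by
  by_contra! hlt
  have hR : 0 ≤ R := by
    obtain ⟨y, _, hy⟩ := hcov 0 le_rfl
    exact (abs_nonneg _).trans hy
  have hδ : 0 < β - 1 - m := by linarith
  -- Chosen so that a point of L in `[β ^ n - 2R - 1, β ^ n)` would exceed `m * β ^ n / (β - 1)`.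
  obtain ⟨n, hn⟩ := pow_unbounded_of_one_lt
    (R + 1 + (2 * R + 1) * (β - 1) / (β - 1 - m)) hβ
  have h1 : 0 ≤ (2 * R + 1) * (β - 1) / (β - 1 - m) := by
    have : 0 ≤ β - 1 := by linarith
    positivity
  obtain ⟨y, hy, hxy⟩ := hcov (β ^ n - R - 1) (by linarith)
  rw [abs_le] at hxy
  have h2 := le_of_mem_polynomialValues_of_lt hβ hy (n := n) (by linarith)
  have h3 : (2 * R + 1) * (β - 1) / (β - 1 - m) < β ^ n := by linarith
  rw [div_lt_iff₀ hδ] at h3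
  nlinarith

theorem isIntegral_of_cover (hβ : 1 < β) (hm : 1 ≤ m) {R : ℝ}
    (hcov : ∀ x, 0 ≤ x → ∃ y ∈ polynomialValues (Set.Icc 0 m) β, |x - y| ≤ R)
    (hfin : IsLocallyFinite (polynomialValues (Set.Icc 0 m) β - polynomialValues (Set.Icc 0 m) β)) :
    IsIntegral ℤ β := by
  set L := polynomialValues (Set.Icc 0 m) β with hL
  have hR : 0 ≤ R := by
    obtain ⟨y, _, hy⟩ := hcov 0 le_rfl
    exact (abs_nonneg _).trans hy
  -- A point of L within R of `x - R - 1` lies between 1 and 2R + 1 below x: the steps are bounded,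
  -- and each descends by at least 1.
  set D := (L - L) ∩ Set.Icc (-(2 * R + 1)) (2 * R + 1) with hD
  have hDfg : (Submodule.span ℤ D).FG := Submodule.fg_span (hfin _)
  have hspan : ∀ n : ℕ, ∀ x ∈ L, x ≤ n → x ∈ Submodule.span ℤ D := by
    intro n
    induction n with
    | zero =>
      intro x hx hxn
      have hx0 : 0 ≤ x := nonneg_of_mem_polynomialValues (by linarith) hx
      have : x = 0 := le_antisymm (by simpa using hxn) hx0
      rw [this]
      exact zero_mem _
    | succ n ih =>
      intro x hx hxn
      push_cast at hxn
      have hx0 : 0 ≤ x := nonneg_of_mem_polynomialValues (by linarith) hx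
      rcases le_or_gt x (R + 1) with hxR | hxR
      · exact Submodule.subset_span
          ⟨⟨x, hx, 0, zero_mem_polynomialValues, sub_zero x⟩, by linarith, by linarith⟩
      · obtain ⟨y, hy, hxy⟩ := hcov (x - R - 1) (by linarith)
        rw [abs_le] at hxy
        have h1 : x - y ∈ Submodule.span ℤ D :=
          Submodule.subset_span ⟨⟨x, hx, y, hy, rfl⟩, by linarith, by linarith⟩
        have h2 := add_mem h1 (ih y hy (by linarith))
        rwa [sub_add_cancel] at h2
  have hle : Subalgebra.toSubmodule (Algebra.adjoin ℤ {β}) ≤ Submodule.span ℤ D := by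
    rw [Algebra.adjoin_eq_span, Submodule.span_le]
    rintro _ hx
    obtain ⟨i, rfl⟩ := Submonoid.mem_closure_singleton.mp hx
    have := sum_pow_mem_polynomialValues (β := β) hm {i}
    rw [Finset.sum_singleton] at this
    obtain ⟨n, hn⟩ := exists_nat_ge (β ^ i)
    exact hspan n _ this hn
  exact IsIntegral.of_mem_of_fg _ (hDfg.of_le hle) β (Algebra.self_mem_adjoin_singleton ℤ β)

theorem isPisot_of_cover (hβ : 1 < β) {R : ℝ}
    (hcov : ∀ x, 0 ≤ x → ∃ y ∈ polynomialValues (Set.Icc 0 m) β, |x - y| ≤ R)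
    (hfin : IsLocallyFinite (polynomialValues (Set.Icc 0 m) β - polynomialValues (Set.Icc 0 m) β -
      polynomialValues (Set.Icc 0 m) β)) :
    β ≤ m + 1 ∧ IsPisot β := by
  have hβ0 : 0 ≤ β := by linarith
  have hβm := le_add_one_of_cover hβ hcov
  have hm : 1 ≤ m := by
    have : (0 : ℝ) < m := by linarith
    exact_mod_cast this
  have hpow := sum_pow_mem_polynomialValues (β := β) hm
  have hint := fun x (hx : x ∈ polynomialValues (Set.Icc 0 m) β) =>
    exists_int_of_mem_polynomialValues hx
  have hmulL := fun x (hx : x ∈ polynomialValues (Set.Icc 0 m) β) => mul_mem_polynomialValues hx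
  have h0 : (0 : ℝ) ∈ polynomialValues (Set.Icc 0 m) β := zero_mem_polynomialValues
  have hnonneg := fun x (hx : x ∈ polynomialValues (Set.Icc 0 m) β) =>
    nonneg_of_mem_polynomialValues hβ0 hx
  have hintegral : IsIntegral ℤ β := isIntegral_of_cover hβ hm hcov <| hfin.mono fun x hx =>
    ⟨x, hx, 0, h0, sub_zero x⟩
  refine ⟨hβm, hβ, hintegral, fun z hz hzβ => ?_⟩
  set L := polynomialValues (Set.Icc 0 m) β with hL
  obtain ⟨s, hs⟩ := exists_conjugation hz
  -- `s` is bounded on the elements of `L - L - L` of bounded size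
  have hsbound : ∀ T : ℝ, ∃ K, ∀ x ∈ L - L - L, |x| ≤ T → ‖s x‖ ≤ K := by
    intro T
    obtain ⟨K, hK⟩ := ((hfin T).image fun x => ‖s x‖).bddAbove
    exact ⟨K, fun x hx hxT => hK ⟨x, ⟨hx, abs_le.mp hxT⟩, rfl⟩⟩
  have hssub : ∀ a ∈ L, ∀ b ∈ L, ∀ c ∈ L, s (a - b - c) = s a - s b - s c := by
    intro a ha b hb c hc
    obtain ⟨P, -, rfl⟩ := hint a ha
    obtain ⟨Q, -, rfl⟩ := hint b hb
    obtain ⟨W, -, rfl⟩ := hint c hc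
    rw [← map_sub, ← map_sub, hs, hs, hs, hs, map_sub, map_sub]
  have hsmul : ∀ a ∈ L, s (β * a) = z * s a := by
    intro a ha
    obtain ⟨P, -, rfl⟩ := hint a ha
    have := hs (Polynomial.X * P)
    rw [map_mul, map_mul, Polynomial.aeval_X, Polynomial.aeval_X] at this
    rw [this, hs]
  have hs0 : s 0 = 0 := by
    have := hs 0
    rwa [map_zero, map_zero] at this
  have hssub2 : ∀ a ∈ L, ∀ b ∈ L, s (a - b) = s a - s b := by
    intro a ha b hb
    have := hssub a ha b hb 0 h0
    rwa [hs0, sub_zero, sub_zero] at this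
  have hmem2 : ∀ a ∈ L, ∀ b ∈ L, a - b ∈ L - L - L := fun a ha b hb =>
    ⟨a - b, ⟨a, ha, b, hb, rfl⟩, 0, h0, sub_zero _⟩
  have hR : 0 ≤ R := by
    obtain ⟨y, _, hy⟩ := hcov 0 le_rfl
    exact (abs_nonneg _).trans hy
  have hcov' : ∀ x : ℝ, ∃ y, 0 ≤ x → y ∈ L ∧ |x - y| ≤ R := fun x => by
    by_cases hx : 0 ≤ x
    · obtain ⟨y, hy⟩ := hcov x hx
      exact ⟨y, fun _ => hy⟩
    · exact ⟨0, fun h => absurd h hx⟩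
  choose y hy using hcov'
  -- Each of the three approximations in y(u + v) - y(u) - y(v) costs at most R; in y(βu) - βy(u)
  -- the cost is R + βR.
  obtain ⟨K₁, hK₁⟩ := hsbound (3 * R)
  obtain ⟨K₂, hK₂⟩ := hsbound (R + β * R)
  obtain ⟨B, hB⟩ := bounded_of_approx_additive (φ := fun x => s (y x)) (C := max K₁ K₂) hβ0 hzβ
    (by
      intro u v hu hv
      obtain ⟨h1, h2⟩ := hy u hu
      obtain ⟨h3, h4⟩ := hy v hv
      obtain ⟨h5, h6⟩ := hy (u + v) (by positivity)
      rw [← hssub _ h5 _ h1 _ h3]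
      refine (hK₁ _ ⟨_, ⟨_, h5, _, h1, rfl⟩, _, h3, rfl⟩ ?_).trans (le_max_left _ _)
      rw [abs_le] at *
      constructor <;> linarith)
    (by
      intro u hu
      obtain ⟨h1, h2⟩ := hy u hu
      obtain ⟨h3, h4⟩ := hy (β * u) (by positivity)
      rw [← hsmul _ h1, ← hssub2 _ h3 _ (hmulL _ h1)]
      refine (hK₂ _ (hmem2 _ h3 _ (hmulL _ h1)) ?_).trans (le_max_right _ _)
      rw [abs_le] at *
      constructor <;> nlinarith)
    (by
      intro T
      obtain ⟨K, hK⟩ := hsbound (T + R)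
      refine ⟨K, fun x hx hxT => ?_⟩
      obtain ⟨h1, h2⟩ := hy x hx
      have h3 := hmem2 _ h1 0 h0
      rw [sub_zero] at h3
      refine hK _ h3 ?_
      rw [abs_le] at *
      constructor <;> linarith)
  obtain ⟨K, hK⟩ := hsbound R
  refine norm_lt_one_of_norm_sum_pow_le (B := B + K) fun S => ?_
  have hx := hpow S
  obtain ⟨h1, h2⟩ := hy _ (hnonneg _ hx)
  have h3 := hK _ (hmem2 _ hx _ h1) h2
  rw [hssub2 _ hx _ h1] at h3
  have h4 := hB _ (hnonneg _ hx)
  have h5 := hs (∑ i ∈ S, Polynomial.X ^ i)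
  simp only [map_sum, map_pow, Polynomial.aeval_X] at h5
  rw [← h5]
  have h6 := norm_le_norm_add_norm_sub (s (y (∑ i ∈ S, β ^ i))) (s (∑ i ∈ S, β ^ i))
  rw [norm_sub_rev] at h6
  linarith

end Necessity

/-! ### Consequences of the Meyer property -/

theorem IsHalfLineMeyer.exists_cover {L : Set ℝ} (h : IsHalfLineMeyer L) :
    ∃ R, ∀ x, 0 ≤ x → ∃ y ∈ L, |x - y| ≤ R := by
  obtain ⟨-, hD, -⟩ := h
  obtain ⟨R, -, hcov⟩ := (isDelone_iff.mp hD).2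
  refine ⟨R, fun x hx => ?_⟩
  obtain ⟨y, hy, hxy⟩ := hcov ⟨x, hx⟩
  exact ⟨y, hy, hxy⟩

theorem IsHalfLineMeyer.isLocallyFinite_sub_sub {L : Set ℝ} (h : IsHalfLineMeyer L) :
    IsLocallyFinite (L - L - L) := by
  obtain ⟨hL, hD, G, hG, hLG⟩ := h
  obtain ⟨r, hr, hsep⟩ := (isDelone_iff.mp hD).1
  have h1 : IsLocallyFinite L := .of_separated hr fun x hx y hy hxy =>
    hsep ⟨x, hL hx⟩ hx ⟨y, hL hy⟩ hy fun he => hxy (congrArg NNReal.toReal he)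
  have hcase : ∀ a ∈ L, ∀ b ∈ L, a - b ∈ L + G ∨ b - a ∈ L + G := by
    intro a ha b hb
    rcases le_total b a with hab | hab
    · exact .inl (hLG ⟨⟨a, ha, b, hb, rfl⟩, sub_nonneg.mpr hab⟩)
    · exact .inr (hLG ⟨⟨b, hb, a, ha, rfl⟩, sub_nonneg.mpr hab⟩)
  have h2 : IsLocallyFinite (L - L) := by
    refine ((h1.add_finite hG).union (h1.add_finite hG).neg).mono ?_
    rintro _ ⟨a, ha, b, hb, rfl⟩
    rcases hcase a ha b hb with hab | hab
    · exact .inl hab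
    · refine .inr ?_
      rwa [Set.mem_neg, neg_sub]
  -- If b - a = w + g instead, then a - b - c = -(w + c + g), and L + L is locally finite because L
  -- is nonnegative.
  refine ((h2.add_finite hG).union ((h1.add_of_nonneg hL).add_finite hG).neg).mono ?_
  rintro _ ⟨_, ⟨a, ha, b, hb, rfl⟩, c, hc, rfl⟩
  rcases hcase a ha b hb with ⟨w, hw, g, hg, hwg⟩ | ⟨w, hw, g, hg, hwg⟩
  · refine .inl ⟨w - c, ⟨w, hw, c, hc, rfl⟩, g, hg, ?_⟩
    simp only at hwg ⊢
    linarith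
  · refine .inr ⟨w + c, ⟨w, hw, c, hc, rfl⟩, g, hg, ?_⟩
    simp only at hwg ⊢
    linarith

theorem IsMeyer.isLocallyFinite_sub_sub {S : Set ℝ} (h : IsMeyer S) :
    IsLocallyFinite (S - S - S) := by
  obtain ⟨hD, G, hG, hSG⟩ := h
  obtain ⟨r, hr, hsep⟩ := (isDelone_iff.mp hD).1
  have h1 : IsLocallyFinite S := .of_separated hr hsep
  refine (((h1.add_finite hG).mono hSG).add_finite hG).mono ?_
  rintro _ ⟨_, ⟨a, ha, b, hb, rfl⟩, c, hc, rfl⟩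
  obtain ⟨w, hw, g, hg, hwg⟩ := hSG ⟨a, ha, b, hb, rfl⟩
  refine ⟨w - c, ⟨w, hw, c, hc, rfl⟩, g, hg, ?_⟩
  simp only at hwg ⊢
  linarith

/-! ### Sufficiency -/

section Sufficiency

variable {β : ℝ} {m : ℕ}

/-- Differences of elements of `S` are finite perturbations of elements of `S`, provided that
`S` is relatively dense and consists of values of integer polynomials with bounded
coefficients. -/
theorem IsPisot.exists_finite_sub_subset (hβ : IsPisot β) {S D : Set ℝ}
    (hS : ∀ x ∈ S, ∃ P : ℤ[X], (∀ i, |P.coeff i| ≤ m) ∧ Polynomial.aeval β P = x)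
    (hDS : D ⊆ S - S) (hcov : ∀ x ∈ D, ∃ y ∈ S, |x - y| ≤ 1) :
    ∃ G : Set ℝ, G.Finite ∧ D ⊆ S + G := by
  -- The error x - y is a combination of three elements of S, hence the coefficient bound 3m.
  refine ⟨_, hβ.isLocallyFinite (3 * m) 1, fun x hx => ?_⟩
  obtain ⟨y, hy, hxy⟩ := hcov x hx
  refine ⟨y, hy, x - y, ⟨?_, abs_le.mp hxy⟩, add_sub_cancel y x⟩
  obtain ⟨a, ha, b, hb, rfl⟩ := hDS hx
  obtain ⟨P, hP, rfl⟩ := hS a ha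
  obtain ⟨Q, hQ, rfl⟩ := hS b hb
  obtain ⟨W, hW, rfl⟩ := hS y hy
  refine ⟨P - Q - W, fun i => ?_, by simp⟩
  have h1 := abs_le.mp (hP i)
  have h2 := abs_le.mp (hQ i)
  have h3 := abs_le.mp (hW i)
  rw [Polynomial.coeff_sub, Polynomial.coeff_sub, abs_le]
  push_cast
  constructor <;> linarith

theorem IsPisot.exists_separated (hβ : IsPisot β) {S : Set ℝ}
    (hS : ∀ x ∈ S, ∃ P : ℤ[X], (∀ i, |P.coeff i| ≤ m) ∧ Polynomial.aeval β P = x) :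
    ∃ r : ℝ, 0 < r ∧ ∀ x ∈ S, ∀ y ∈ S, x ≠ y → r < |x - y| := by
  obtain ⟨r, hr, h⟩ := (hβ.isLocallyFinite (2 * m)).exists_lt_abs
  refine ⟨r, hr, fun x hx y hy hxy => h _ ?_ (sub_ne_zero.mpr hxy)⟩
  obtain ⟨P, hP, rfl⟩ := hS x hx
  obtain ⟨Q, hQ, rfl⟩ := hS y hy
  refine ⟨P - Q, fun i => ?_, by simp⟩
  have h1 := abs_le.mp (hP i)
  have h2 := abs_le.mp (hQ i)
  rw [Polynomial.coeff_sub, abs_le]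
  push_cast
  constructor <;> linarith

theorem IsPisot.isHalfLineMeyer (hβ : IsPisot β) (hm : β ≤ m + 1) :
    IsHalfLineMeyer (polynomialValues (Set.Icc 0 m) β) := by
  have hS := fun x (hx : x ∈ polynomialValues (Set.Icc 0 m) β) =>
    exists_int_of_mem_polynomialValues hx
  refine ⟨fun x hx => nonneg_of_mem_polynomialValues (by linarith [hβ.1]) hx,
    isDelone_iff.mpr ⟨?_, 1, one_pos, fun x => ?_⟩,
    hβ.exists_finite_sub_subset hS Set.inter_subset_left
      fun x hx => exists_mem_polynomialValues_near hβ.1 hm hx.2⟩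
  · obtain ⟨r, hr, h⟩ := hβ.exists_separated hS
    exact ⟨r, hr, fun x hx y hy hxy => h _ hx _ hy fun he => hxy (NNReal.coe_injective he)⟩
  · obtain ⟨y, hy, hxy⟩ := exists_mem_polynomialValues_near hβ.1 hm x.2
    exact ⟨⟨y, nonneg_of_mem_polynomialValues (by linarith [hβ.1]) hy⟩, hy, hxy⟩

theorem IsPisot.isMeyer (hβ : IsPisot β) (hm : β ≤ m + 1) :
    IsMeyer (polynomialValues (Set.Icc 0 m) β ∪ -polynomialValues (Set.Icc 0 m) β) := by
  have hS : ∀ x ∈ polynomialValues (Set.Icc 0 m) β ∪ -polynomialValues (Set.Icc 0 m) β,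
      ∃ P : ℤ[X], (∀ i, |P.coeff i| ≤ m) ∧ Polynomial.aeval β P = x := by
    rintro x (hx | hx)
    · exact exists_int_of_mem_polynomialValues hx
    · obtain ⟨P, hP, hPx⟩ := exists_int_of_mem_polynomialValues hx
      exact ⟨-P, by simpa using hP, by rw [map_neg, hPx, neg_neg]⟩
  have hcov : ∀ x : ℝ,
      ∃ y ∈ polynomialValues (Set.Icc 0 m) β ∪ -polynomialValues (Set.Icc 0 m) β, |x - y| ≤ 1 := by
    intro x
    rcases le_total 0 x with hx | hx
    · obtain ⟨y, hy, hxy⟩ := exists_mem_polynomialValues_near hβ.1 hm hx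
      exact ⟨y, .inl hy, hxy⟩
    · obtain ⟨y, hy, hxy⟩ := exists_mem_polynomialValues_near hβ.1 hm (neg_nonneg.mpr hx)
      refine ⟨-y, .inr (by rwa [Set.mem_neg, neg_neg]), ?_⟩
      rwa [← abs_neg, show -(x - -y) = -x - y by ring]
  exact ⟨isDelone_iff.mpr ⟨hβ.exists_separated hS, 1, one_pos, hcov⟩,
    hβ.exists_finite_sub_subset hS le_rfl fun x _ => hcov x⟩

end Sufficiency

theorem mainTheorem1 (β : ℝ) (hβ : 1 < β) (m : ℕ) :
    (IsHalfLineMeyer (polynomialValues (Set.Icc 0 m) β) ↔ β ≤ (m : ℝ) + 1 ∧ IsPisot β) ∧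
    (IsMeyer (polynomialValues (Set.Icc 0 m) β ∪ -polynomialValues (Set.Icc 0 m) β) ↔
      β ≤ (m : ℝ) + 1 ∧ IsPisot β) := by
  refine ⟨⟨fun h => ?_, fun h => h.2.isHalfLineMeyer h.1⟩, fun h => ?_, fun h => h.2.isMeyer h.1⟩
  · obtain ⟨R, hR⟩ := h.exists_cover
    exact isPisot_of_cover hβ hR h.isLocallyFinite_sub_sub
  · obtain ⟨R, -, hR⟩ := (isDelone_iff.mp h.1).2
    refine isPisot_of_cover hβ (R := R) (fun x hx => ?_) (h.isLocallyFinite_sub_sub.mono ?_)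
    · obtain ⟨y, hy | hy, hxy⟩ := hR x
      · exact ⟨y, hy, hxy⟩
      -- Here y ≤ 0 ≤ x, so 0 is at least as close to x as y is.
      · have hy0 := nonneg_of_mem_polynomialValues (by linarith) hy
        rw [Real.dist_eq] at hxy
        refine ⟨0, zero_mem_polynomialValues, ?_⟩
        rw [abs_le] at hxy ⊢
        constructor <;> linarith
    · exact Set.sub_subset_sub (Set.sub_subset_sub Set.subset_union_left Set.subset_union_left)
        Set.subset_union_left
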